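/- Setting. An MPMAB problem instance with $M$ players and $K$ arms assigns to each player $p\in[M]$ and each arm $i\in[K]$ a reward distribution $\mathcal D_i^p$ on $[0,1]$, with mean $\mu_i^p$. Put $\mu_*^p=\max_{i\in[K]}\mu_i^p$ and $\Delta_i^p=\mu_*^p-\mu_i^p$. For $\epsilon\in[0,1]$, it is an $\epsilon$-MPMAB instance if $|\mu_i^p-\mu_i^q|\le\epsilon$ for all players $p,q$ and all arms $i$; its set of subpar arms is $\mathcal I_\epsilon=\{i\in[K]:\ \exists p\in[M],\ \Delta_i^p>5\epsilon\}$. An algorithm $\mathcal A$ with horizon $T$ is a sequence $\pi_1,\dots,\pi_T$, where $\pi_t$ is a conditional probability distribution of the arms $(i_t^p)_{p\in[M]}$ pulled by all players in round $t$, given the data $(i_s^p,r_s^p)_{s<t,\,p\in[M]}$; given the past and the arms of round $t$, the rewards $r_t^p\sim\mathcal D^p_{i_t^p}$, $p\in[M]$, are drawn independently. With $n_i^p(T)$ the number of pulls of arm $i$ by player $p$ in the $T$ rounds, the (expected) collective regret is $\mathbb E[\mathcal R(T)]=\sum_{p\in[M]}\sum_{i\in[K]}\Delta_i^p\,\mathbb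 E[n_i^p(T)]$. Theorem. There is a universal constant $c>0$ such that the following holds. For all integers $K\ge2$, $M\ge1$, $T\ge K$ and all integers $l,l^C\ge0$ with $l\le K-1$ and $l+l^C=K$, there exists $\epsilon>0$ such that for every algorithm $\mathcal A$ for $M$ players and $K$ arms with horizon $T$ there exists an $\epsilon$-MPMAB problem instance in which $|\mathcal I_\epsilon|\ge l$ and the expected collective regret of $\mathcal A$ satisfies $$\mathbb E[\mathcal R(T)]\ \ge\ c\left(M\sqrt{(l^C-1)\,T}+\sqrt{M\,l\,T}\right).$$ -/

import Mathlib

open MeasureTheory ProbabilityTheory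

namespace MPMAB

noncomputable section

/-- A multi-player multi-armed bandit problem instance with `M` players and `K` arms: each player
`p` and each arm `i` carries a reward distribution, a probability measure on `[0,1]`. -/
structure Instance (M K : ℕ) where
  dist : Fin M → Fin K → Measure unitInterval
  isProb : ∀ p i, IsProbabilityMeasure (dist p i)

attribute [instance] Instance.isProb

/-- The mean reward of arm `i` for player `p`. -/
def Instance.mean {M K : ℕ} (E : Instance M K) (p : Fin M) (i : Fin K) : ℝ :=
  ∫ x : unitInterval, (x : ℝ) ∂(E.dist p i)

/-- The optimal mean reward of player `p`. -/
def Instance.optMean {M K : ℕ} (E : Instance M K) (p : Fin M) : ℝ :=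
  ⨆ i : Fin K, E.mean p i

/-- The suboptimality gap of arm `i` for player `p`. -/
def Instance.gap {M K : ℕ} (E : Instance M K) (p : Fin M) (i : Fin K) : ℝ :=
  E.optMean p - E.mean p i

/-- The instance is an `ε`-MPMAB problem instance, with dissimilarity parameter `ε ∈ [0,1]`. -/
def Instance.IsDissimilar {M K : ℕ} (E : Instance M K) (ε : ℝ) : Prop :=
  ε ∈ Set.Icc (0 : ℝ) 1 ∧ ∀ (p q : Fin M) (i : Fin K), |E.mean p i - E.mean q i| ≤ ε

/-- The set of subpar arms: those whose gap exceeds `5 ε` for some player. -/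
def Instance.subpar {M K : ℕ} (E : Instance M K) (ε : ℝ) : Set (Fin K) :=
  {i | ∃ p : Fin M, E.gap p i > 5 * ε}

/-- The record of one round: the arms pulled by all players and the rewards they received. -/
abbrev Round (M K : ℕ) : Type := (Fin M → Fin K) × (Fin M → unitInterval)

/-- The record of the first `t` rounds. -/
abbrev History (M K t : ℕ) : Type := Fin t → Round M K

/-- A multi-player bandit algorithm with horizon `T`: for each of the `T` rounds, a conditional
probability distribution of the arms pulled by all players, given all the data of all players
from the previous rounds. (Rounds are counted from `0`.) -/
structure Algorithm (M K T : ℕ) where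
  policy : (t : Fin T) → Kernel (History M K t) (Fin M → Fin K)
  isMarkov : ∀ t, IsMarkovKernel (policy t)

attribute [instance] Algorithm.isMarkov

/-- Given the arms pulled by the players in a round, the rewards of the players are drawn
independently, each from the distribution of the player's own arm. -/
def Instance.rewardKernel {M K : ℕ} (E : Instance M K) :
    Kernel (Fin M → Fin K) (Fin M → unitInterval) :=
  Kernel.ofFunOfCountable fun a => Measure.pi fun p => E.dist p (a p)

instance Instance.isMarkovKernel_rewardKernel {M K : ℕ} (E : Instance M K) :
    IsMarkovKernel E.rewardKernel :=
  ⟨fun a => inferInstanceAs (IsProbabilityMeasure (Measure.pi fun p => E.dist p (a p)))⟩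

/-- The conditional distribution of the record of round `t`, given the past. -/
def Algorithm.roundKernel {M K T : ℕ} (A : Algorithm M K T) (E : Instance M K) (t : Fin T) :
    Kernel (History M K t) (Round M K) :=
  A.policy t ⊗ₖ Kernel.prodMkLeft (History M K t) E.rewardKernel

instance Algorithm.isMarkovKernel_roundKernel {M K T : ℕ} (A : Algorithm M K T)
    (E : Instance M K) (t : Fin T) : IsMarkovKernel (A.roundKernel E t) := by
  unfold Algorithm.roundKernel
  infer_instance

/-- Append the record of a further round to a history. -/
def History.snoc {M K t : ℕ} (x : History M K t × Round M K) : History M K (t + 1) :=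
  Fin.snoc (α := fun _ => Round M K) x.1 x.2

theorem History.measurable_snoc {M K t : ℕ} :
    Measurable (History.snoc : History M K t × Round M K → History M K (t + 1)) := by
  refine measurable_pi_lambda _ fun i => ?_
  induction i using Fin.lastCases with
  | last => simpa [History.snoc] using measurable_snd
  | cast j =>
    simp only [History.snoc, Fin.snoc_castSucc]
    exact (measurable_pi_apply j).comp measurable_fst

/-- The joint law of the arm pulls and rewards of all players in the first `t` rounds, when the
algorithm interacts with the instance. -/
def Algorithm.law {M K T : ℕ} (A : Algorithm M K T) (E : Instance M K) :
    (t : ℕ) → t ≤ T → Measure (History M K t)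
  | 0, _ => Measure.dirac Fin.elim0
  | t + 1, h =>
      (A.law E t (Nat.le_of_succ_le h) ⊗ₘ A.roundKernel E ⟨t, h⟩).map History.snoc

instance Algorithm.isProbabilityMeasure_law {M K T : ℕ} (A : Algorithm M K T)
    (E : Instance M K) (t : ℕ) (h : t ≤ T) : IsProbabilityMeasure (A.law E t h) := by
  induction t with
  | zero => unfold Algorithm.law; infer_instance
  | succ t ih =>
    have := ih (Nat.le_of_succ_le h)
    have : IsMarkovKernel (α := History M K t) (A.roundKernel E ⟨t, h⟩) :=
      A.isMarkovKernel_roundKernel E ⟨t, h⟩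
    have : IsProbabilityMeasure
        (A.law E t (Nat.le_of_succ_le h) ⊗ₘ A.roundKernel E ⟨t, h⟩) := by infer_instance
    unfold Algorithm.law
    exact Measure.isProbabilityMeasure_map History.measurable_snoc.aemeasurable

/-- The number of pulls of arm `i` by player `p` in a history. -/
def pulls {M K t : ℕ} (p : Fin M) (i : Fin K) (h : History M K t) : ℕ :=
  (Finset.univ.filter fun s : Fin t => (h s).1 p = i).card

/-- The expected regret of player `p` over the whole horizon. -/
def Algorithm.playerRegret {M K T : ℕ} (A : Algorithm M K T) (E : Instance M K) (p : Fin M) : ℝ :=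
  ∑ i : Fin K, E.gap p i * ∫ h, (pulls p i h : ℝ) ∂(A.law E T le_rfl)

/-- The expected collective regret of all players over the whole horizon. -/
def Algorithm.collectiveRegret {M K T : ℕ} (A : Algorithm M K T) (E : Instance M K) : ℝ :=
  ∑ p : Fin M, A.playerRegret E p

end

end MPMAB

namespace MPMAB

noncomputable section

/-! Since `max x y ≥ (x + y) / 2`, it suffices to treat separately the cases in which one of the two
terms dominates, each with its own family of Bernoulli instances with means near `1/2`.

If `√(M l T)` dominates, all players share one best arm, hidden among all `K` and better by `Δ`.
They act as one player with `M T` pulls in a `K`-armed bandit, which costs order `√(K M T)`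
(`exists_hard_common`). If `M √((lC - 1) T)` dominates, every player has a best arm of their own
among the first `lC` arms, chosen independently, while the other `l` arms have mean zero. Data of
other players are then uninformative, and each player separately pays order `√(lC T)`
(`exists_hard_own`).

Both bounds come from one estimate, `Algorithm.le_sum_playerRegret_bump`. Raising one arm from `1/2`
to `1/2 + Δ` multiplies the law of the history by an explicit likelihood (`Algorithm.law_bump`),
whose relative entropy is at most `4 Δ²` per expected pull of that arm. A Pinsker-type inequality
(`abs_sub_one_le`) turns this into a bound on how much the expected number of pulls can grow. Under
the base law the arms share the available pulls, so for `Δ` of order `√(n / X)`, with `n` arms and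
`X` pulls, a raised arm on average stays unpulled in at least a quarter of the rounds. -/

open scoped ENNReal unitInterval

/-! ### Bernoulli rewards and densities of product measures. -/

/-- The Bernoulli law with success probability `q`, as a measure on the unit interval. -/
def bernoulli (q : I) : Measure I :=
  ENNReal.ofReal (1 - (q : ℝ)) • Measure.dirac 0 + ENNReal.ofReal (q : ℝ) • Measure.dirac 1

instance isProbabilityMeasure_bernoulli (q : I) : IsProbabilityMeasure (bernoulli q) := by
  refine ⟨?_⟩
  simp only [bernoulli, Measure.coe_add, Measure.coe_smul, Pi.add_apply, Pi.smul_apply,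
    measure_univ, smul_eq_mul, mul_one]
  rw [← ENNReal.ofReal_add (by linarith [q.2.2]) q.2.1]
  simp

theorem lintegral_bernoulli (q : I) (F : I → ℝ≥0∞) :
    ∫⁻ x, F x ∂bernoulli q = ENNReal.ofReal (1 - (q : ℝ)) * F 0 + ENNReal.ofReal (q : ℝ) * F 1 := by
  simp [bernoulli, lintegral_add_measure, lintegral_smul_measure]

theorem integral_bernoulli (q : I) (F : I → ℝ) :
    ∫ x, F x ∂bernoulli q = (1 - (q : ℝ)) * F 0 + q * F 1 := by
  have h (y : I) : Integrable F (Measure.dirac y) := integrable_dirac (by simp)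
  rw [bernoulli, integral_add_measure ((h 0).smul_measure ENNReal.ofReal_ne_top)
    ((h 1).smul_measure ENNReal.ofReal_ne_top), integral_smul_measure, integral_smul_measure,
    ENNReal.toReal_ofReal (by linarith [q.2.2]), ENNReal.toReal_ofReal q.2.1]
  simp

/-- The Bernoulli instance with prescribed mean rewards. -/
def bernoulliInstance {M K : ℕ} (m : Fin M → Fin K → I) : Instance M K where
  dist p i := bernoulli (m p i)
  isProb _ _ := inferInstance

theorem mean_bernoulliInstance {M K : ℕ} (m : Fin M → Fin K → I) (p : Fin M) (i : Fin K) :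
    (bernoulliInstance m).mean p i = m p i := by
  simp [Instance.mean, bernoulliInstance, integral_bernoulli]

theorem bernoulli_eq_withDensity {q q' : I} {Δ : ℝ} (hq : (q : ℝ) = 1 / 2)
    (hq' : (q' : ℝ) = 1 / 2 + Δ) :
    bernoulli q' = (bernoulli q).withDensity
      fun x => ENNReal.ofReal (1 + 2 * Δ * (2 * (x : ℝ) - 1)) := by
  have h1 := q'.2.2
  have h0 := q'.2.1
  ext s hs
  rw [withDensity_apply _ hs, ← lintegral_indicator hs, ← lintegral_indicator_one hs,
    lintegral_bernoulli, lintegral_bernoulli]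
  have e0 : ENNReal.ofReal (1 - (q' : ℝ)) =
      ENNReal.ofReal (1 - (q : ℝ)) * ENNReal.ofReal (1 + 2 * Δ * (2 * ((0 : I) : ℝ) - 1)) := by
    rw [← ENNReal.ofReal_mul (by rw [hq]; norm_num), hq, hq']
    congr 1
    simp
    ring
  have e1 : ENNReal.ofReal (q' : ℝ) =
      ENNReal.ofReal (q : ℝ) * ENNReal.ofReal (1 + 2 * Δ * (2 * ((1 : I) : ℝ) - 1)) := by
    rw [← ENNReal.ofReal_mul (by rw [hq]; norm_num), hq, hq']
    congr 1
    simp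
    ring
  rw [e0, e1]
  by_cases h0 : (0 : I) ∈ s <;> by_cases h1 : (1 : I) ∈ s <;> simp [h0, h1]

/-- On a box, the indicator times the density is a product of functions of single coordinates, which
are independent under `Measure.pi ν`, so its integral factors. -/
theorem pi_withDensity {ι : Type*} [Fintype ι] {X : ι → Type*} [∀ i, MeasurableSpace (X i)]
    (ν : ∀ i, Measure (X i)) [∀ i, IsProbabilityMeasure (ν i)] {g : ∀ i, X i → ℝ≥0∞}
    (hg : ∀ i, Measurable (g i)) [∀ i, SigmaFinite ((ν i).withDensity (g i))] :
    Measure.pi (fun i => (ν i).withDensity (g i)) =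
      (Measure.pi ν).withDensity fun x => ∏ i, g i (x i) := by
  refine Measure.pi_eq fun s hs => ?_
  rw [withDensity_apply _ (MeasurableSet.univ_pi hs),
    ← lintegral_indicator (MeasurableSet.univ_pi hs)]
  have hm (i : ι) : Measurable ((s i).indicator (g i)) := (hg i).indicator (hs i)
  have e : (Set.univ.pi s).indicator (fun x => ∏ i, g i (x i)) =
      fun x => ∏ i, (s i).indicator (g i) (x i) := by
    ext x
    by_cases hx : x ∈ Set.univ.pi s
    · rw [Set.indicator_of_mem hx]
      refine Finset.prod_congr rfl fun i _ => ?_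
      rw [Set.indicator_of_mem (hx i trivial)]
    · rw [Set.indicator_of_notMem hx]
      simp only [Set.mem_pi, Set.mem_univ, true_implies, not_forall] at hx
      obtain ⟨i, hi⟩ := hx
      exact (Finset.prod_eq_zero (Finset.mem_univ i) (Set.indicator_of_notMem hi _)).symm
  have hI : iIndepFun (fun i x => (s i).indicator (g i) (x i)) (Measure.pi ν) :=
    iIndepFun_pi (X := fun i => (s i).indicator (g i)) fun i => (hm i).aemeasurable
  rw [e]
  refine (lintegral_prod_eq_prod_lintegral_of_indepFun Finset.univ _ hI
    fun i => (hm i).comp (measurable_pi_apply i)).trans ?_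
  refine Finset.prod_congr rfl fun i _ => ?_
  rw [withDensity_apply _ (hs i), ← lintegral_indicator (hs i)]
  exact (measurePreserving_eval ν i).lintegral_comp (hm i)

/-! ### Likelihood ratios and change of measure. -/

variable {M K : ℕ}

/-- The mean matrix `m'` is obtained from `m` by raising the mean of arm `j` from `1/2` to
`1/2 + Δ` for all players in `S`. -/
structure IsBump (S : Finset (Fin M)) (j : Fin K) (Δ : ℝ) (m m' : Fin M → Fin K → I) : Prop where
  base : ∀ p ∈ S, (m p j : ℝ) = 1 / 2
  raised : ∀ p ∈ S, (m' p j : ℝ) = 1 / 2 + Δ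
  other : ∀ p i, ¬(p ∈ S ∧ i = j) → m' p i = m p i

/-- The likelihood ratio of a single round for a bump of arm `j` by `Δ`. -/
def ratio (S : Finset (Fin M)) (j : Fin K) (Δ : ℝ) (x : Round M K) : ℝ :=
  ∏ p, if p ∈ S ∧ x.1 p = j then 1 + 2 * Δ * (2 * (x.2 p : ℝ) - 1) else 1

theorem measurableSet_arm (p : Fin M) (j : Fin K) : MeasurableSet {x : Round M K | x.1 p = j} :=
  (measurableSet_singleton j).preimage (show Measurable fun x : Round M K => x.1 p by fun_prop)

theorem measurable_ratio (S : Finset (Fin M)) (j : Fin K) (Δ : ℝ) :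
    Measurable (ratio (K := K) S j Δ) := by
  refine Finset.measurable_prod _ fun p _ => ?_
  refine Measurable.ite ((MeasurableSet.const _).inter (measurableSet_arm p j)) ?_ measurable_const
  fun_prop

/-- Bernoulli rewards only take the values 0 and 1, but the density is affine in `x`, so its bounds
hold on all of `I` and positivity of the likelihood needs no exceptional null set. -/
theorem one_sub_le_factor {Δ : ℝ} (h0 : 0 ≤ Δ) (x : I) :
    1 - 2 * Δ ≤ 1 + 2 * Δ * (2 * (x : ℝ) - 1) := by
  nlinarith [x.2.1]

theorem factor_le_one_add {Δ : ℝ} (h0 : 0 ≤ Δ) (x : I) :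
    1 + 2 * Δ * (2 * (x : ℝ) - 1) ≤ 1 + 2 * Δ := by
  nlinarith [x.2.2]

theorem ratio_pos (S : Finset (Fin M)) (j : Fin K) {Δ : ℝ} (h0 : 0 ≤ Δ) (h1 : Δ ≤ 1 / 4)
    (x : Round M K) : 0 < ratio S j Δ x := by
  refine Finset.prod_pos fun p _ => ?_
  split_ifs
  · linarith [one_sub_le_factor h0 (x.2 p)]
  · exact one_pos

theorem rewardKernel_eq_withDensity {S : Finset (Fin M)} {j : Fin K} {Δ : ℝ}
    {m m' : Fin M → Fin K → I} (hb : IsBump S j Δ m m') (h0 : 0 ≤ Δ) (h1 : Δ ≤ 1 / 4)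
    (a : Fin M → Fin K) :
    (bernoulliInstance m').rewardKernel a = ((bernoulliInstance m).rewardKernel a).withDensity
      fun r => ENNReal.ofReal (ratio S j Δ (a, r)) := by
  change Measure.pi (fun p => bernoulli (m' p (a p))) =
    (Measure.pi fun p => bernoulli (m p (a p))).withDensity _
  let g (p : Fin M) (x : I) : ℝ≥0∞ :=
    ENNReal.ofReal (if p ∈ S ∧ a p = j then 1 + 2 * Δ * (2 * (x : ℝ) - 1) else 1)
  have hg (p : Fin M) : Measurable (g p) := by
    refine ENNReal.measurable_ofReal.comp ?_
    split_ifs <;> fun_prop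
  have key (p : Fin M) : bernoulli (m' p (a p)) = (bernoulli (m p (a p))).withDensity (g p) := by
    by_cases h : p ∈ S ∧ a p = j
    · have := bernoulli_eq_withDensity (hb.base p h.1) (hb.raised p h.1)
      simpa [g, h] using this
    · rw [hb.other _ _ h]
      simp [g, h]
  have hp (p : Fin M) : IsProbabilityMeasure ((bernoulli (m p (a p))).withDensity (g p)) := by
    rw [← key]; infer_instance
  simp_rw [key]
  rw [pi_withDensity _ hg]
  congr 1
  ext r
  rw [ratio, ENNReal.ofReal_prod_of_nonneg]
  intro p _
  split_ifs
  · linarith [one_sub_le_factor h0 (r p)]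
  · exact zero_le_one

/-- The conditional law of the record of round `t`, as a kernel from histories of length `t`. -/
def Algorithm.step {T : ℕ} (A : Algorithm M K T) (E : Instance M K) (t : ℕ) (h : t < T) :
    Kernel (History M K t) (Round M K) :=
  A.roundKernel E ⟨t, h⟩

instance Algorithm.isMarkovKernel_step {T : ℕ} (A : Algorithm M K T) (E : Instance M K) (t : ℕ)
    (h : t < T) : IsMarkovKernel (A.step E t h) :=
  A.isMarkovKernel_roundKernel E ⟨t, h⟩

theorem Algorithm.law_succ {T : ℕ} (A : Algorithm M K T) (E : Instance M K) (t : ℕ)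
    (h : t + 1 ≤ T) :
    A.law E (t + 1) h = (A.law E t (Nat.le_of_succ_le h) ⊗ₘ A.step E t h).map History.snoc :=
  rfl

theorem Algorithm.lintegral_step {T : ℕ} (A : Algorithm M K T) (E : Instance M K) (t : ℕ)
    (h : t < T) (x : History M K t) {F : Round M K → ℝ≥0∞} (hF : Measurable F) :
    ∫⁻ y, F y ∂A.step E t h x =
      ∫⁻ a, ∫⁻ r, F (a, r) ∂E.rewardKernel a ∂A.policy ⟨t, h⟩ x := by
  have : IsMarkovKernel (α := History M K t) (A.policy ⟨t, h⟩) := A.isMarkov _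
  change ∫⁻ y, F y ∂(A.policy ⟨t, h⟩ ⊗ₖ Kernel.prodMkLeft _ E.rewardKernel) x = _
  rw [Kernel.lintegral_compProd _ _ _ hF]
  rfl

theorem Algorithm.integral_step {T : ℕ} (A : Algorithm M K T) (E : Instance M K) (t : ℕ)
    (h : t < T) (x : History M K t) {F : Round M K → ℝ} (hF : Integrable F (A.step E t h x)) :
    ∫ y, F y ∂A.step E t h x =
      ∫ a, ∫ r, F (a, r) ∂E.rewardKernel a ∂A.policy ⟨t, h⟩ x := by
  have : IsMarkovKernel (α := History M K t) (A.policy ⟨t, h⟩) := A.isMarkov _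
  exact ProbabilityTheory.integral_compProd hF

/-- The likelihood ratio of a history for a bump of arm `j` by `Δ`. -/
def likelihood (S : Finset (Fin M)) (j : Fin K) (Δ : ℝ) {t : ℕ} (h : History M K t) : ℝ :=
  ∏ s, ratio S j Δ (h s)

theorem likelihood_snoc (S : Finset (Fin M)) (j : Fin K) (Δ : ℝ) {t : ℕ} (h : History M K t)
    (x : Round M K) :
    likelihood S j Δ (History.snoc (h, x)) = likelihood S j Δ h * ratio S j Δ x := by
  simp [likelihood, Fin.prod_univ_castSucc, History.snoc]

theorem measurable_likelihood (S : Finset (Fin M)) (j : Fin K) (Δ : ℝ) (t : ℕ) :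
    Measurable (likelihood S j Δ : History M K t → ℝ) :=
  Finset.measurable_prod _ fun s _ => (measurable_ratio S j Δ).comp (measurable_pi_apply s)

theorem likelihood_pos (S : Finset (Fin M)) (j : Fin K) {Δ : ℝ} (h0 : 0 ≤ Δ) (h1 : Δ ≤ 1 / 4)
    {t : ℕ} (h : History M K t) : 0 < likelihood S j Δ h :=
  Finset.prod_pos fun _ _ => ratio_pos S j h0 h1 _

section ChangeOfMeasure

variable {T : ℕ} (A : Algorithm M K T) {S : Finset (Fin M)} {j : Fin K} {Δ : ℝ}
  {m m' : Fin M → Fin K → I}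

/-- The policy is the same under both instances, so only the rewards contribute to the density. -/
theorem Algorithm.lintegral_step_bump (hb : IsBump S j Δ m m') (h0 : 0 ≤ Δ) (h1 : Δ ≤ 1 / 4)
    (t : ℕ) (h : t < T) (x : History M K t) {F : Round M K → ℝ≥0∞} (hF : Measurable F) :
    ∫⁻ y, F y ∂A.step (bernoulliInstance m') t h x =
      ∫⁻ y, F y * ENNReal.ofReal (ratio S j Δ y) ∂A.step (bernoulliInstance m) t h x := by
  have hg : Measurable fun y : Round M K => ENNReal.ofReal (ratio S j Δ y) :=
    ENNReal.measurable_ofReal.comp (measurable_ratio S j Δ)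
  have hFg : Measurable fun y : Round M K => F y * ENNReal.ofReal (ratio S j Δ y) := hF.mul hg
  rw [A.lintegral_step _ t h x hF, A.lintegral_step _ t h x hFg]
  refine lintegral_congr fun a => ?_
  rw [rewardKernel_eq_withDensity hb h0 h1 a]
  refine (lintegral_withDensity_eq_lintegral_mul _ (hg.comp measurable_prodMk_left)
    (hF.comp measurable_prodMk_left)).trans ?_
  exact lintegral_congr fun r => mul_comm _ _

/-- Testing against functions with values in `ℝ≥0∞` lets the induction on rounds run without
integrability conditions. -/
theorem Algorithm.lintegral_law_bump (hb : IsBump S j Δ m m') (h0 : 0 ≤ Δ) (h1 : Δ ≤ 1 / 4)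
    (t : ℕ) (ht : t ≤ T) {F : History M K t → ℝ≥0∞} (hF : Measurable F) :
    ∫⁻ h, F h ∂A.law (bernoulliInstance m') t ht =
      ∫⁻ h, F h * ENNReal.ofReal (likelihood S j Δ h) ∂A.law (bernoulliInstance m) t ht := by
  induction t with
  | zero => simp [Algorithm.law, likelihood]
  | succ t ih =>
    have hg : Measurable fun y : Round M K => ENNReal.ofReal (ratio S j Δ y) :=
      ENNReal.measurable_ofReal.comp (measurable_ratio S j Δ)
    have hl : Measurable fun h : History M K (t + 1) => ENNReal.ofReal (likelihood S j Δ h) :=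
      ENNReal.measurable_ofReal.comp (measurable_likelihood S j Δ _)
    have hFs : Measurable fun y : History M K t × Round M K => F (History.snoc y) :=
      hF.comp History.measurable_snoc
    have hFg : Measurable fun y : History M K t × Round M K =>
        F (History.snoc y) * ENNReal.ofReal (ratio S j Δ y.2) :=
      hFs.mul (hg.comp measurable_snd)
    have hFl : Measurable fun h : History M K (t + 1) =>
        F h * ENNReal.ofReal (likelihood S j Δ h) := hF.mul hl
    have hFls : Measurable fun y : History M K t × Round M K =>
        F (History.snoc y) * ENNReal.ofReal (likelihood S j Δ (History.snoc y)) :=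
      hFl.comp History.measurable_snoc
    rw [A.law_succ, A.law_succ, lintegral_map hF History.measurable_snoc,
      lintegral_map hFl History.measurable_snoc, Measure.lintegral_compProd hFs,
      Measure.lintegral_compProd hFls]
    rw [lintegral_congr fun h => A.lintegral_step_bump hb h0 h1 t ht h
      (F := fun y => F (History.snoc (h, y))) (hFs.comp measurable_prodMk_left)]
    rw [ih (Nat.le_of_succ_le ht) hFg.lintegral_kernel_prod_right']
    refine lintegral_congr fun h => ?_
    refine (lintegral_mul_const _ (hFg.comp measurable_prodMk_left)).symm.trans ?_
    refine lintegral_congr fun y => ?_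
    rw [Function.comp_apply, likelihood_snoc, ENNReal.ofReal_mul (likelihood_pos S j h0 h1 h).le]
    ring

theorem Algorithm.law_bump (hb : IsBump S j Δ m m') (h0 : 0 ≤ Δ) (h1 : Δ ≤ 1 / 4)
    (t : ℕ) (ht : t ≤ T) :
    A.law (bernoulliInstance m') t ht = (A.law (bernoulliInstance m) t ht).withDensity
      fun h => ENNReal.ofReal (likelihood S j Δ h) := by
  ext s hs
  rw [withDensity_apply _ hs, ← lintegral_indicator hs, ← lintegral_indicator_one hs,
    A.lintegral_law_bump hb h0 h1 t ht (measurable_one.indicator hs)]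
  refine lintegral_congr fun h => ?_
  by_cases hh : h ∈ s <;> simp [hh]

theorem Algorithm.integral_law_bump (hb : IsBump S j Δ m m') (h0 : 0 ≤ Δ) (h1 : Δ ≤ 1 / 4)
    (t : ℕ) (ht : t ≤ T) (F : History M K t → ℝ) :
    ∫ h, F h ∂A.law (bernoulliInstance m') t ht =
      ∫ h, likelihood S j Δ h * F h ∂A.law (bernoulliInstance m) t ht := by
  have hl : Measurable fun h : History M K t => ENNReal.ofReal (likelihood S j Δ h) :=
    ENNReal.measurable_ofReal.comp (measurable_likelihood S j Δ t)
  rw [A.law_bump hb h0 h1, integral_withDensity_eq_integral_toReal_smul hl (by simp)]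
  simp [ENNReal.toReal_ofReal (likelihood_pos S j h0 h1 _).le]

theorem Algorithm.integrable_likelihood (hb : IsBump S j Δ m m') (h0 : 0 ≤ Δ) (h1 : Δ ≤ 1 / 4)
    (t : ℕ) (ht : t ≤ T) :
    Integrable (likelihood S j Δ) (A.law (bernoulliInstance m) t ht) := by
  refine ⟨(measurable_likelihood S j Δ t).aestronglyMeasurable, ?_⟩
  rw [hasFiniteIntegral_iff_ofReal (ae_of_all _ fun h => (likelihood_pos S j h0 h1 h).le)]
  have := A.lintegral_law_bump hb h0 h1 t ht (F := fun _ => 1) measurable_const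
  simp only [lintegral_const, measure_univ, one_mul] at this
  rw [← this]
  simp

theorem Algorithm.integral_likelihood (hb : IsBump S j Δ m m') (h0 : 0 ≤ Δ) (h1 : Δ ≤ 1 / 4)
    (t : ℕ) (ht : t ≤ T) :
    ∫ h, likelihood S j Δ h ∂A.law (bernoulliInstance m) t ht = 1 := by
  have := A.integral_law_bump hb h0 h1 t ht fun _ => 1
  simpa using this.symm

end ChangeOfMeasure

/-! ### Pull counts and the relative entropy of a bump. -/

theorem Algorithm.integrable_sum_rounds {T : ℕ} (A : Algorithm M K T) (E : Instance M K) (t : ℕ)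
    (ht : t ≤ T) {φ : Round M K → ℝ} (hφ : Measurable φ) {C : ℝ} (hC : ∀ x, |φ x| ≤ C) :
    Integrable (fun h => ∑ s, φ (h s)) (A.law E t ht) :=
  integrable_finsetSum _ fun s _ => .of_bound
    (hφ.comp (measurable_pi_apply s)).aestronglyMeasurable C (ae_of_all _ fun _ => hC _)

/-- The partial sums form a submartingale: the conditional mean of each term is nonnegative whatever
arms are pulled, so the adaptivity of the algorithm plays no role. -/
theorem Algorithm.integral_sum_rounds_nonneg {T : ℕ} (A : Algorithm M K T) (E : Instance M K)
    (t : ℕ) (ht : t ≤ T) {φ : Round M K → ℝ} (hφ : Measurable φ) {C : ℝ} (hC : ∀ x, |φ x| ≤ C)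
    (h : ∀ a, 0 ≤ ∫ r, φ (a, r) ∂E.rewardKernel a) :
    0 ≤ ∫ h, ∑ s, φ (h s) ∂A.law E t ht := by
  induction t with
  | zero => simp
  | succ t ih =>
    have hm (n : ℕ) : Measurable fun h : History M K n => ∑ s, φ (h s) :=
      Finset.measurable_sum _ fun s _ => hφ.comp (measurable_pi_apply s)
    have i2 : Integrable (fun y : History M K t × Round M K => φ y.2)
        (A.law E t (Nat.le_of_succ_le ht) ⊗ₘ A.step E t ht) :=
      .of_bound (hφ.comp measurable_snd).aestronglyMeasurable C (ae_of_all _ fun _ => hC _)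
    have i1 : Integrable (fun y : History M K t × Round M K => ∑ s, φ (y.1 s))
        (A.law E t (Nat.le_of_succ_le ht) ⊗ₘ A.step E t ht) :=
      integrable_finsetSum _ fun s _ => .of_bound
        (hφ.comp ((measurable_pi_apply s).comp measurable_fst)).aestronglyMeasurable C
        (ae_of_all _ fun _ => hC _)
    rw [A.law_succ, integral_map History.measurable_snoc.aemeasurable
      (hm _).aestronglyMeasurable]
    simp only [Fin.sum_univ_castSucc, History.snoc, Fin.snoc_castSucc, Fin.snoc_last]
    rw [integral_add i1 i2, Measure.integral_compProd i1, Measure.integral_compProd i2]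
    refine add_nonneg ?_ ?_
    · simpa using ih (Nat.le_of_succ_le ht)
    · refine integral_nonneg fun x => ?_
      have i3 : Integrable φ (A.step E t ht x) :=
        .of_bound hφ.aestronglyMeasurable C (ae_of_all _ fun _ => hC _)
      change 0 ≤ ∫ y, φ y ∂A.step E t ht x
      rw [A.integral_step E t ht x i3]
      exact integral_nonneg h

/-- A pointwise form of Pinsker's inequality. Integrated against a law under which `L` has mean 1,
it bounds `∫ |L - 1|` by relative entropy over `2 η` plus `2 η`. The proof passes through the
Hellinger quantity `(√L - 1)²`. -/
theorem abs_sub_one_le {L η : ℝ} (hL : 0 < L) (hη : 0 < η) :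
    |L - 1| ≤ (L - 1 - Real.log L) / (2 * η) + η * (L + 1) := by
  obtain ⟨u, hu, rfl⟩ : ∃ u : ℝ, 0 < u ∧ L = u ^ 2 :=
    ⟨√L, Real.sqrt_pos.2 hL, (Real.sq_sqrt hL.le).symm⟩
  have h1 : (u - 1) ^ 2 ≤ u ^ 2 - 1 - Real.log (u ^ 2) := by
    rw [Real.log_pow]
    have := Real.log_le_sub_one_of_pos hu
    push_cast
    nlinarith
  have h2 : |u ^ 2 - 1| ≤ (u - 1) ^ 2 / (2 * η) + η * (u ^ 2 + 1) := by
    have h3 : |u ^ 2 - 1| = |u - 1| * (u + 1) := by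
      rw [show u ^ 2 - 1 = (u - 1) * (u + 1) by ring, abs_mul,
        abs_of_pos (show 0 < u + 1 by linarith)]
    -- Completing the square, with `2 (u² + 1) = (u + 1)² + (u - 1)²`.
    have h4 : (u - 1) ^ 2 / (2 * η) + η * (u ^ 2 + 1) - |u - 1| * (u + 1) =
        ((|u - 1| - η * (u + 1)) ^ 2 + η ^ 2 * (u - 1) ^ 2) / (2 * η) := by
      rw [← sq_abs (u - 1)]
      field_simp
      rw [show u - 1 = u + -1 by ring] at *
      nlinarith [sq_abs (u + -1)]
    rw [h3]
    have : 0 ≤ ((|u - 1| - η * (u + 1)) ^ 2 + η ^ 2 * (u - 1) ^ 2) / (2 * η) := by positivity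
    linarith
  have h5 := div_le_div_of_nonneg_right h1 (show 0 ≤ 2 * η by positivity)
  linarith

theorem abs_log_le_one {y : ℝ} (h0 : 1 / 2 ≤ y) (h1 : y ≤ 3 / 2) : |Real.log y| ≤ 1 := by
  have hy : 0 < y := by linarith
  rw [abs_le]
  constructor
  · have := Real.one_sub_inv_le_log_of_pos hy
    have : y⁻¹ ≤ 2 := by
      rw [inv_le_comm₀ hy two_pos]
      linarith
    linarith
  · linarith [Real.log_le_sub_one_of_pos hy]

/-- The number of pulls of arm `j` by the players in `S`. -/
def groupPulls (S : Finset (Fin M)) (j : Fin K) {t : ℕ} (h : History M K t) : ℝ :=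
  ∑ p ∈ S, (pulls p j h : ℝ)

theorem pulls_eq_sum (p : Fin M) (j : Fin K) {t : ℕ} (h : History M K t) :
    (pulls p j h : ℝ) = ∑ s, if (h s).1 p = j then (1 : ℝ) else 0 := by
  simp [pulls]

theorem measurable_pulls (p : Fin M) (j : Fin K) (t : ℕ) :
    Measurable fun h : History M K t => (pulls p j h : ℝ) := by
  simp_rw [pulls_eq_sum]
  exact Finset.measurable_sum _ fun s _ => Measurable.ite
    ((measurableSet_arm p j).preimage (measurable_pi_apply s)) measurable_const measurable_const

theorem measurable_groupPulls (S : Finset (Fin M)) (j : Fin K) (t : ℕ) :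
    Measurable (groupPulls S j : History M K t → ℝ) :=
  Finset.measurable_sum _ fun p _ => measurable_pulls p j t

theorem pulls_le (p : Fin M) (j : Fin K) {t : ℕ} (h : History M K t) : (pulls p j h : ℝ) ≤ t := by
  have := Finset.card_filter_le (Finset.univ : Finset (Fin t)) fun s => (h s).1 p = j
  rw [Finset.card_univ, Fintype.card_fin] at this
  exact_mod_cast this

theorem groupPulls_nonneg (S : Finset (Fin M)) (j : Fin K) {t : ℕ} (h : History M K t) :
    0 ≤ groupPulls S j h :=
  Finset.sum_nonneg fun _ _ => Nat.cast_nonneg _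

theorem groupPulls_le (S : Finset (Fin M)) (j : Fin K) {t : ℕ} (h : History M K t) :
    groupPulls S j h ≤ S.card * t := by
  rw [← nsmul_eq_mul]
  exact Finset.sum_le_card_nsmul S _ (t : ℝ) fun p _ => pulls_le p j h

theorem sum_pulls (p : Fin M) {t : ℕ} (h : History M K t) :
    ∑ i : Fin K, (pulls p i h : ℝ) = t := by
  simp_rw [pulls_eq_sum]
  rw [Finset.sum_comm]
  simp

theorem sum_groupPulls_le (S : Finset (Fin M)) {n : ℕ} {e : Fin n → Fin K}
    (he : Function.Injective e) {t : ℕ} (h : History M K t) :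
    ∑ i, groupPulls S (e i) h ≤ S.card * t := by
  simp only [groupPulls]
  rw [Finset.sum_comm]
  have (p : Fin M) : ∑ i, (pulls p (e i) h : ℝ) ≤ t := by
    rw [← sum_pulls p h]
    refine (Finset.sum_map Finset.univ ⟨e, he⟩ fun i => (pulls p i h : ℝ)).symm.trans_le ?_
    exact Finset.sum_le_univ_sum_of_nonneg fun _ => Nat.cast_nonneg _
  simpa using Finset.sum_le_card_nsmul S _ (t : ℝ) fun p _ => this p

theorem integrable_pulls {t : ℕ} (μ : Measure (History M K t)) [IsProbabilityMeasure μ]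
    (p : Fin M) (j : Fin K) : Integrable (fun h => (pulls p j h : ℝ)) μ :=
  .of_bound (measurable_pulls p j t).aestronglyMeasurable t (ae_of_all _ fun h => by
    rw [Real.norm_of_nonneg (Nat.cast_nonneg _)]
    exact pulls_le p j h)

theorem integrable_groupPulls {t : ℕ} (μ : Measure (History M K t)) [IsProbabilityMeasure μ]
    (S : Finset (Fin M)) (j : Fin K) : Integrable (groupPulls S j) μ :=
  integrable_finsetSum _ fun p _ => integrable_pulls μ p j

/-- The log-likelihood ratio of a single round, compensated by `4 Δ²` for every pull of arm `j`
by a player in `S`. -/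
def compensatedLog (S : Finset (Fin M)) (j : Fin K) (Δ : ℝ) (x : Round M K) : ℝ :=
  ∑ p, if p ∈ S ∧ x.1 p = j then Real.log (1 + 2 * Δ * (2 * (x.2 p : ℝ) - 1)) + 4 * Δ ^ 2 else 0

theorem measurable_compensatedLog (S : Finset (Fin M)) (j : Fin K) (Δ : ℝ) :
    Measurable (compensatedLog (K := K) S j Δ) := by
  refine Finset.measurable_sum _ fun p _ => ?_
  refine Measurable.ite ((MeasurableSet.const _).inter (measurableSet_arm p j)) ?_ measurable_const
  fun_prop

theorem abs_compensatedTerm_le {Δ : ℝ} (h0 : 0 ≤ Δ) (h1 : Δ ≤ 1 / 4) (x : I) :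
    |Real.log (1 + 2 * Δ * (2 * (x : ℝ) - 1)) + 4 * Δ ^ 2| ≤ 2 := by
  have h2 := abs_log_le_one (y := 1 + 2 * Δ * (2 * (x : ℝ) - 1))
    (by linarith [one_sub_le_factor h0 x]) (by linarith [factor_le_one_add h0 x])
  refine (abs_add_le _ _).trans ?_
  rw [abs_of_nonneg (show 0 ≤ 4 * Δ ^ 2 by positivity)]
  nlinarith

theorem abs_compensatedLog_le (S : Finset (Fin M)) (j : Fin K) {Δ : ℝ} (h0 : 0 ≤ Δ)
    (h1 : Δ ≤ 1 / 4) (x : Round M K) : |compensatedLog S j Δ x| ≤ M * 2 := by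
  refine (Finset.abs_sum_le_sum_abs _ _).trans ?_
  refine (Finset.sum_le_card_nsmul _ _ (2 : ℝ) fun p _ => ?_).trans (by simp)
  split_ifs
  · exact abs_compensatedTerm_le h0 h1 _
  · simp

theorem sum_compensatedLog (S : Finset (Fin M)) (j : Fin K) {Δ : ℝ} (h0 : 0 ≤ Δ)
    (h1 : Δ ≤ 1 / 4) {t : ℕ} (h : History M K t) :
    ∑ s, compensatedLog S j Δ (h s) =
      Real.log (likelihood S j Δ h) + 4 * Δ ^ 2 * groupPulls S j h := by
  have e1 : 4 * Δ ^ 2 * groupPulls S j h =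
      ∑ s, ∑ p, if p ∈ S ∧ (h s).1 p = j then 4 * Δ ^ 2 else 0 := by
    simp_rw [groupPulls, pulls_eq_sum]
    rw [Finset.sum_comm, Finset.mul_sum]
    refine Finset.sum_congr rfl fun s _ => ?_
    rw [Finset.mul_sum, ← Finset.sum_filter_add_sum_filter_not Finset.univ (· ∈ S)]
    simp [ite_and, ← Finset.sum_filter]
  rw [likelihood, Real.log_prod fun s _ => (ratio_pos S j h0 h1 _).ne', e1,
    ← Finset.sum_add_distrib]
  refine Finset.sum_congr rfl fun s _ => ?_
  rw [ratio, Real.log_prod, ← Finset.sum_add_distrib]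
  · refine Finset.sum_congr rfl fun p _ => ?_
    split_ifs <;> simp
  · intro p _
    split_ifs
    · linarith [one_sub_le_factor h0 ((h s).2 p)]
    · exact one_ne_zero

/-- A relevant pull has mean log-ratio `log (1 - 4 Δ²) / 2`, and this is at least `-4 Δ²` because `1
/ (1 - y) ≤ 1 + 2 y` for `0 ≤ y ≤ 1/2`. -/
theorem integral_compensatedLog_nonneg {S : Finset (Fin M)} {j : Fin K} {Δ : ℝ} (h0 : 0 ≤ Δ)
    (h1 : Δ ≤ 1 / 4) {m : Fin M → Fin K → I} (hm : ∀ p ∈ S, (m p j : ℝ) = 1 / 2)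
    (a : Fin M → Fin K) :
    0 ≤ ∫ r, compensatedLog S j Δ (a, r) ∂(bernoulliInstance m).rewardKernel a := by
  change 0 ≤ ∫ r, compensatedLog S j Δ (a, r) ∂Measure.pi fun p => bernoulli (m p (a p))
  let f (p : Fin M) (x : I) : ℝ :=
    if p ∈ S ∧ a p = j then Real.log (1 + 2 * Δ * (2 * (x : ℝ) - 1)) + 4 * Δ ^ 2 else 0
  have hf (p : Fin M) : Measurable (f p) := by
    simp only [f]
    split_ifs <;> fun_prop
  have hi (p : Fin M) : Integrable (f p) (bernoulli (m p (a p))) := by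
    refine .of_bound (hf p).aestronglyMeasurable 2 (ae_of_all _ fun x => ?_)
    simp only [f, Real.norm_eq_abs]
    split_ifs
    · exact abs_compensatedTerm_le h0 h1 _
    · simp
  have e : ∫ r, compensatedLog S j Δ (a, r) ∂(Measure.pi fun p => bernoulli (m p (a p))) =
      ∑ p, ∫ x, f p x ∂bernoulli (m p (a p)) := by
    rw [show (fun r => compensatedLog S j Δ (a, r)) = fun r => ∑ p, f p (r p) from rfl,
      integral_finsetSum _ fun p _ => integrable_comp_eval (hi p)]
    exact Finset.sum_congr rfl fun p _ => integral_comp_eval (hf p).aestronglyMeasurable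
  rw [e]
  refine Finset.sum_nonneg fun p _ => ?_
  by_cases hp : p ∈ S ∧ a p = j
  · have hq : (m p (a p) : ℝ) = 1 / 2 := by rw [hp.2, hm p hp.1]
    simp only [f, hp, and_self, if_true]
    rw [integral_bernoulli, ← hp.2, hq]
    have hy : 4 * Δ ^ 2 ≤ 1 / 2 := by nlinarith
    have hl := Real.one_sub_inv_le_log_of_pos (show 0 < 1 - 4 * Δ ^ 2 by linarith)
    have e2 : Real.log (1 - 4 * Δ ^ 2) = Real.log (1 - 2 * Δ) + Real.log (1 + 2 * Δ) := by
      rw [← Real.log_mul (by linarith) (by linarith)]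
      congr 1
      ring
    have hinv : (1 - 4 * Δ ^ 2)⁻¹ ≤ 1 + 2 * (4 * Δ ^ 2) := by
      rw [inv_le_iff_one_le_mul₀ (by linarith)]
      nlinarith [sq_nonneg Δ]
    have e3 : (1 + 2 * Δ * (2 * ((0 : I) : ℝ) - 1)) = 1 - 2 * Δ := by simp; ring
    have e4 : (1 + 2 * Δ * (2 * ((1 : I) : ℝ) - 1)) = 1 + 2 * Δ := by simp; ring
    rw [e3, e4]
    linarith
  · simp [f, hp]

/-! ### How far a bump can raise the expected number of pulls. -/

section Deviation

variable {T : ℕ} (A : Algorithm M K T) {S : Finset (Fin M)} {j : Fin K} {Δ η : ℝ}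
  {m m' : Fin M → Fin K → I}

theorem Algorithm.integrable_log_likelihood (S : Finset (Fin M)) (j : Fin K) (h0 : 0 ≤ Δ)
    (h1 : Δ ≤ 1 / 4) (E : Instance M K) (t : ℕ) (ht : t ≤ T) :
    Integrable (fun h => Real.log (likelihood S j Δ h)) (A.law E t ht) := by
  have := (A.integrable_sum_rounds E t ht (measurable_compensatedLog S j Δ)
    (abs_compensatedLog_le S j h0 h1)).sub
    ((integrable_groupPulls (A.law E t ht) S j).const_mul (4 * Δ ^ 2))
  refine this.congr (ae_of_all _ fun h => ?_)
  simp [sum_compensatedLog S j h0 h1]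

theorem Algorithm.neg_integral_log_likelihood_le (h0 : 0 ≤ Δ) (h1 : Δ ≤ 1 / 4)
    (hm : ∀ p ∈ S, (m p j : ℝ) = 1 / 2) (t : ℕ) (ht : t ≤ T) :
    -∫ h, Real.log (likelihood S j Δ h) ∂A.law (bernoulliInstance m) t ht ≤
      4 * Δ ^ 2 * ∫ h, groupPulls S j h ∂A.law (bernoulliInstance m) t ht := by
  have h := A.integral_sum_rounds_nonneg (bernoulliInstance m) t ht
    (measurable_compensatedLog S j Δ) (abs_compensatedLog_le S j h0 h1)
    (integral_compensatedLog_nonneg h0 h1 hm)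
  simp_rw [sum_compensatedLog S j h0 h1] at h
  rw [integral_add (A.integrable_log_likelihood S j h0 h1 _ t ht)
    ((integrable_groupPulls _ S j).const_mul _), integral_const_mul] at h
  linarith

/-- The pull count lies in `[0, X]` with `X = S.card * t`, so its mean grows by at most `X ∫ |L -
1|`, to which the Pinsker-type inequality and the entropy bound apply. -/
theorem Algorithm.integral_groupPulls_bump_le (hb : IsBump S j Δ m m') (h0 : 0 ≤ Δ)
    (h1 : Δ ≤ 1 / 4) (hη : 0 < η) (t : ℕ) (ht : t ≤ T) :
    ∫ h, groupPulls S j h ∂A.law (bernoulliInstance m') t ht ≤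
      ∫ h, groupPulls S j h ∂A.law (bernoulliInstance m) t ht +
        S.card * t * (4 * Δ ^ 2 * (∫ h, groupPulls S j h ∂A.law (bernoulliInstance m) t ht) /
          (2 * η) + 2 * η) := by
  set μ := A.law (bernoulliInstance m) t ht with hμ
  set X : ℝ := S.card * t
  have hX : 0 ≤ X := by positivity
  have iN : Integrable (groupPulls S j) μ := integrable_groupPulls μ S j
  have iL : Integrable (likelihood S j Δ) μ := A.integrable_likelihood hb h0 h1 t ht
  have ilog : Integrable (fun h => Real.log (likelihood S j Δ h)) μ :=
    A.integrable_log_likelihood S j h0 h1 _ t ht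
  have iL1 : Integrable (fun h => likelihood S j Δ h - 1) μ := iL.sub (integrable_const 1)
  have iR1 : Integrable (fun h => (likelihood S j Δ h - 1 - Real.log (likelihood S j Δ h)) /
      (2 * η)) μ := (iL1.sub ilog).div_const _
  have iR2 : Integrable (fun h => η * (likelihood S j Δ h + 1)) μ :=
    (iL.add (integrable_const 1)).const_mul η
  have iR : Integrable (fun h => X * ((likelihood S j Δ h - 1 - Real.log (likelihood S j Δ h)) /
      (2 * η) + η * (likelihood S j Δ h + 1))) μ := (iR1.add iR2).const_mul X
  have iLN : Integrable (fun h => likelihood S j Δ h * groupPulls S j h) μ :=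
    iL.mul_bdd (measurable_groupPulls S j t).aestronglyMeasurable (c := X)
      (ae_of_all _ fun h => by
        rw [Real.norm_of_nonneg (groupPulls_nonneg S j h)]
        exact groupPulls_le S j h)
  rw [A.integral_law_bump hb h0 h1 t ht]
  have key : ∫ h, likelihood S j Δ h * groupPulls S j h ∂μ ≤
      ∫ h, (groupPulls S j h + X * ((likelihood S j Δ h - 1 - Real.log (likelihood S j Δ h)) /
      (2 * η) + η * (likelihood S j Δ h + 1))) ∂μ := by
    refine integral_mono iLN (iN.add iR) fun h => ?_
    have hp := likelihood_pos S j h0 h1 h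
    have hn := groupPulls_nonneg S j h
    have ha := abs_sub_one_le hp hη
    have hb := le_abs_self (likelihood S j Δ h - 1)
    have hc : (likelihood S j Δ h - 1) * groupPulls S j h ≤ |likelihood S j Δ h - 1| * X :=
      mul_le_mul hb (groupPulls_le S j h) hn (abs_nonneg _)
    have hd := mul_le_mul_of_nonneg_right ha hX
    simp only
    linarith
  refine key.trans ?_
  rw [integral_add iN iR, integral_const_mul, integral_add iR1 iR2, integral_div,
    integral_sub iL1 ilog, integral_sub iL (integrable_const 1),
    integral_const_mul, integral_add iL (integrable_const 1),
    A.integral_likelihood hb h0 h1 t ht]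
  have hlog := A.neg_integral_log_likelihood_le h0 h1 hb.base t ht
  rw [← hμ] at hlog
  simp only [integral_const, probReal_univ, smul_eq_mul, mul_one]
  rw [show η * (1 + 1) = 2 * η by ring]
  gcongr
  linarith

/-- If the best arm of the players in `S` is hidden among `n ≥ 2` arms and the gap is of order
`√(n / X)`, with `X` the number of pulls of these players, then on average over the position of
the best arm, the players in `S` pull it in at most three quarters of their rounds. -/
theorem Algorithm.sum_integral_groupPulls_bump_le {n : ℕ} (hn : 2 ≤ n) {e : Fin n → Fin K}
    (he : Function.Injective e) {m₁ : Fin n → Fin M → Fin K → I}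
    (hb : ∀ i, IsBump S (e i) Δ m (m₁ i)) (h0 : 0 ≤ Δ) (h1 : Δ ≤ 1 / 4) (t : ℕ) (ht : t ≤ T)
    (hΔ : 256 * Δ ^ 2 * (S.card * t) = n) :
    ∑ i, ∫ h, groupPulls S (e i) h ∂A.law (bernoulliInstance (m₁ i)) t ht ≤
      3 / 4 * (n * (S.card * t)) := by
  set X : ℝ := S.card * t with hXdef
  have hX : 0 ≤ X := by positivity
  set N : Fin n → ℝ := fun i => ∫ h, groupPulls S (e i) h ∂A.law (bernoulliInstance m) t ht
  have hN : ∑ i, N i ≤ X := by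
    rw [← integral_finsetSum _ fun i _ => integrable_groupPulls _ S (e i)]
    refine (integral_mono (integrable_finsetSum _ fun i _ => integrable_groupPulls _ S (e i))
      (integrable_const X) fun h => sum_groupPulls_le S he h).trans ?_
    simp
  -- With `η = 1/16` the sum over the arms is at most `X (1 + n/8) + n X / 8 = X + n X / 4`, and `X
  -- ≤ n X / 2` because `n ≥ 2`.
  have h2 (i : Fin n) := A.integral_groupPulls_bump_le (η := 1 / 16) (hb i) h0 h1 (by norm_num) t ht
  refine (Finset.sum_le_sum fun i _ => h2 i).trans ?_
  change ∑ i, (N i + X * (4 * Δ ^ 2 * N i / (2 * (1 / 16)) + 2 * (1 / 16))) ≤ _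
  have e1 : ∑ i, (N i + X * (4 * Δ ^ 2 * N i / (2 * (1 / 16)) + 2 * (1 / 16))) =
      (∑ i, N i) * (1 + 32 * Δ ^ 2 * X) + n * X / 8 := by
    rw [Finset.sum_mul, show (n : ℝ) * X / 8 = ∑ _i : Fin n, X / 8 by simp; ring,
      ← Finset.sum_add_distrib]
    exact Finset.sum_congr rfl fun i _ => by ring
  rw [e1]
  have hn' : (2 : ℝ) ≤ n := by exact_mod_cast hn
  have h3 : 32 * Δ ^ 2 * X = n / 8 := by linarith
  rw [h3]
  have h4 : (∑ i, N i) * (1 + n / 8) ≤ X * (1 + n / 8) :=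
    mul_le_mul_of_nonneg_right hN (by positivity)
  nlinarith

end Deviation

/-! ### From pull counts to regret. -/

theorem Instance.sub_le_gap (E : Instance M K) (p : Fin M) (i b : Fin K) :
    E.mean p b - E.mean p i ≤ E.gap p i :=
  sub_le_sub_right (le_ciSup (Set.finite_range (E.mean p)).bddAbove b) _

theorem Instance.gap_nonneg (E : Instance M K) (p : Fin M) (i : Fin K) : 0 ≤ E.gap p i := by
  simpa using E.sub_le_gap p i i

theorem Algorithm.le_playerRegret {T : ℕ} (A : Algorithm M K T) (E : Instance M K) (p : Fin M)
    (b : Fin K) {Δ : ℝ} (hb : ∀ i, i ≠ b → E.mean p i + Δ ≤ E.mean p b) :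
    Δ * (T - ∫ h, (pulls p b h : ℝ) ∂A.law E T le_rfl) ≤ A.playerRegret E p := by
  set N : Fin K → ℝ := fun i => ∫ h, (pulls p i h : ℝ) ∂A.law E T le_rfl
  have hN (i : Fin K) : 0 ≤ N i := integral_nonneg fun _ => Nat.cast_nonneg _
  have hsum : ∑ i, N i = T := by
    rw [← integral_finsetSum _ fun i _ => integrable_pulls _ p i]
    simp [sum_pulls]
  change Δ * (T - N b) ≤ ∑ i, E.gap p i * N i
  rw [← hsum, ← Finset.add_sum_erase _ _ (Finset.mem_univ b),
    ← Finset.add_sum_erase _ (fun i => E.gap p i * N i) (Finset.mem_univ b), add_sub_cancel_left,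
    Finset.mul_sum]
  have h1 := mul_nonneg (E.gap_nonneg p b) (hN b)
  have h2 : ∑ i ∈ Finset.univ.erase b, Δ * N i ≤ ∑ i ∈ Finset.univ.erase b, E.gap p i * N i :=
    Finset.sum_le_sum fun i hi => mul_le_mul_of_nonneg_right
      (by linarith [hb i (Finset.ne_of_mem_erase hi), E.sub_le_gap p i b]) (hN i)
  linarith

theorem Algorithm.le_sum_playerRegret_bump {T n : ℕ} (A : Algorithm M K T) {S : Finset (Fin M)}
    {Δ : ℝ} (hn : 2 ≤ n) {e : Fin n → Fin K} (he : Function.Injective e)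
    {m : Fin M → Fin K → I} {m₁ : Fin n → Fin M → Fin K → I}
    (hb : ∀ i, IsBump S (e i) Δ m (m₁ i)) (h0 : 0 ≤ Δ) (h1 : Δ ≤ 1 / 4)
    (hΔ : 256 * Δ ^ 2 * (S.card * T) = n)
    (hbest : ∀ i, ∀ p ∈ S, ∀ k, k ≠ e i → (m₁ i p k : ℝ) + Δ ≤ m₁ i p (e i)) :
    n * (Δ * (S.card * T) / 4) ≤
      ∑ i, ∑ p ∈ S, A.playerRegret (bernoulliInstance (m₁ i)) p := by
  have h2 := A.sum_integral_groupPulls_bump_le hn he hb h0 h1 T le_rfl hΔ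
  have h3 (i : Fin n) : Δ * (S.card * T -
      ∫ h, groupPulls S (e i) h ∂A.law (bernoulliInstance (m₁ i)) T le_rfl) ≤
      ∑ p ∈ S, A.playerRegret (bernoulliInstance (m₁ i)) p := by
    have : ∫ h, groupPulls S (e i) h ∂A.law (bernoulliInstance (m₁ i)) T le_rfl =
        ∑ p ∈ S, ∫ h, (pulls p (e i) h : ℝ) ∂A.law (bernoulliInstance (m₁ i)) T le_rfl :=
      integral_finsetSum _ fun p _ => integrable_pulls _ p (e i)
    rw [this, show (S.card : ℝ) * T = ∑ _p ∈ S, (T : ℝ) by simp, ← Finset.sum_sub_distrib,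
      Finset.mul_sum]
    refine Finset.sum_le_sum fun p hp => A.le_playerRegret _ p (e i) fun k hk => ?_
    rw [mean_bernoulliInstance, mean_bernoulliInstance]
    exact hbest i p hp k hk
  refine le_trans ?_ (Finset.sum_le_sum fun i _ => h3 i)
  rw [← Finset.mul_sum, Finset.sum_sub_distrib]
  simp only [Finset.sum_const, Finset.card_univ, Fintype.card_fin, nsmul_eq_mul]
  have h4 := mul_le_mul_of_nonneg_left h2 h0
  linarith

/-- Resampling one coordinate preserves the uniform law: swapping the new value `j` with the old
value `a p` is an involution on pairs. -/
theorem sum_sum_update {α ι : Type*} [Fintype α] [DecidableEq α] [Fintype ι]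
    (f : (α → ι) → ℝ) (p : α) :
    ∑ a, ∑ j, f (Function.update a p j) = Fintype.card ι * ∑ a, f a := by
  let τ : (α → ι) × ι → (α → ι) × ι := fun x => (Function.update x.1 p x.2, x.1 p)
  have hτ : Function.Involutive τ := fun x => by simp [τ]
  rw [← Fintype.sum_prod_type' fun a j => f (Function.update a p j),
    ← Equiv.sum_comp hτ.toPerm fun x : (α → ι) × ι => f (Function.update x.1 p x.2)]
  simp [τ, Fintype.sum_prod_type, Finset.mul_sum]

/-- The choice is `Δ = √(n / X) / 16`. The bound `1/16` keeps the means in `[0,1]` and `5 Δ` below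
`1/2 + Δ`. -/
theorem exists_gap {n X : ℝ} (hn : 0 < n) (hX : n ≤ X) :
    ∃ Δ : ℝ, 0 < Δ ∧ Δ ≤ 1 / 16 ∧ 256 * Δ ^ 2 * X = n ∧ Δ * X / 4 = √(n * X) / 64 := by
  have hX0 : 0 < X := hn.trans_le hX
  have h1 : √(n / X) ^ 2 = n / X := Real.sq_sqrt (by positivity)
  have h2 : √(n / X) ≤ 1 := Real.sqrt_le_one.2 ((div_le_one hX0).2 hX)
  refine ⟨√(n / X) / 16, by positivity, by linarith, ?_, ?_⟩
  · rw [div_pow, h1]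
    field_simp
    norm_num
  · have : √(n * X) = √(n / X) * X := by
      rw [Real.sqrt_eq_iff_mul_self_eq (by positivity) (by positivity)]
      calc n * X = √(n / X) ^ 2 * X ^ 2 := by rw [h1]; field_simp
        _ = √(n / X) * X * (√(n / X) * X) := by ring
    rw [this]
    ring

theorem exists_mean {Δ : ℝ} (h0 : 0 ≤ Δ) (h1 : Δ ≤ 1 / 16) : ∃ q : I, (q : ℝ) = 1 / 2 + Δ :=
  ⟨⟨1 / 2 + Δ, by linarith, by linarith⟩, rfl⟩

/-! ### The two families of hard instances. -/

/-- The hard instances in which all players share the same best arm. -/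
theorem exists_hard_common {T l : ℕ} (hK : 2 ≤ K) (hM : 1 ≤ M) (hT : K ≤ T) (hl : l ≤ K - 1) :
    ∃ ε : ℝ, 0 < ε ∧ ∀ A : Algorithm M K T, ∃ E : Instance M K, E.IsDissimilar ε ∧
      l ≤ (E.subpar ε).ncard ∧ √(K * (M * T)) / 64 ≤ A.collectiveRegret E := by
  have hK0 : (0 : ℝ) < K := by exact_mod_cast (by omega : 0 < K)
  have hX : (K : ℝ) ≤ M * T := by exact_mod_cast hT.trans (Nat.le_mul_of_pos_left T hM)
  obtain ⟨Δ, h0, h1, hΔ, hreg⟩ := exists_gap hK0 hX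
  obtain ⟨mid, hmid⟩ := exists_mean le_rfl (by norm_num)
  obtain ⟨hi, hhi⟩ := exists_mean h0.le h1
  rw [add_zero] at hmid
  let m₁ : Fin K → Fin M → Fin K → I := fun j _ i => if i = j then hi else mid
  -- The players are identical, so any `ε` in `[0,1]` is admissible. This one gives `5 ε = Δ / 2 <
  -- Δ`, which makes all arms but the best subpar.
  refine ⟨Δ / 10, by positivity, fun A => ?_⟩
  have hb (j : Fin K) : IsBump Finset.univ (id j) Δ (fun _ _ => mid) (m₁ j) :=
    ⟨fun _ _ => hmid, fun _ _ => by simp [m₁, hhi], fun p i h => by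
      have : i ≠ j := by simpa using h
      simp [m₁, this]⟩
  have hbest (j : Fin K) (p : Fin M) (k : Fin K) (hk : k ≠ j) :
      (m₁ j p k : ℝ) + Δ ≤ m₁ j p j := by
    simp [m₁, hk, hmid, hhi]
  have hsum := A.le_sum_playerRegret_bump hK Function.injective_id hb h0.le (by linarith)
    (by simpa using hΔ) fun j p _ k hk => hbest j p k hk
  have hne : (Finset.univ : Finset (Fin K)).Nonempty := ⟨⟨0, by omega⟩, Finset.mem_univ _⟩
  obtain ⟨j, -, hj⟩ := Finset.exists_le_of_sum_le hne
    (f := fun _ => Δ * (M * T) / 4)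
    (g := fun j => A.collectiveRegret (bernoulliInstance (m₁ j))) (by
      simpa [Algorithm.collectiveRegret] using hsum)
  refine ⟨bernoulliInstance (m₁ j), ⟨⟨by positivity, by linarith⟩, fun p q i => ?_⟩, ?_, ?_⟩
  · rw [mean_bernoulliInstance, mean_bernoulliInstance]
    simp only [m₁, sub_self, abs_zero]
    positivity
  · have hsub : ((Finset.univ.erase j : Finset (Fin K)) : Set (Fin K)) ⊆
        (bernoulliInstance (m₁ j)).subpar (Δ / 10) := fun i hi' => by
      have hij : i ≠ j := by simpa using hi'
      refine ⟨⟨0, hM⟩, ?_⟩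
      have h2 := (bernoulliInstance (m₁ j)).sub_le_gap ⟨0, hM⟩ i j
      rw [mean_bernoulliInstance, mean_bernoulliInstance] at h2
      linarith [hbest j ⟨0, hM⟩ i hij]
    have h3 := Set.ncard_le_ncard hsub (Set.toFinite _)
    rw [Set.ncard_coe_finset, Finset.card_erase_of_mem (Finset.mem_univ j), Finset.card_univ,
      Fintype.card_fin] at h3
    omega
  · rw [← hreg]
    exact hj

/-- The mean matrix in which player `p` has best arm `a p` among the first `n` arms, while all
further arms have mean zero. -/
def ownMeans {n : ℕ} (hn : n ≤ K) (hi mid : I) (a : Fin M → Fin n) (p : Fin M) (i : Fin K) : I :=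
  if i = Fin.castLE hn (a p) then hi else if (i : ℕ) < n then mid else 0

theorem isBump_ownMeans {n : ℕ} (hn : n ≤ K) {hi mid : I} {Δ : ℝ} (hmid : (mid : ℝ) = 1 / 2)
    (hhi : (hi : ℝ) = 1 / 2 + Δ) (a : Fin M → Fin n) (p : Fin M) (j : Fin n) :
    IsBump {p} (Fin.castLE hn j) Δ
      (fun q i => if q = p then if (i : ℕ) < n then mid else 0 else ownMeans hn hi mid a q i)
      (ownMeans hn hi mid (Function.update a p j)) := by
  refine ⟨fun q hq => ?_, fun q hq => ?_, fun q i h => ?_⟩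
  · rw [Finset.mem_singleton] at hq
    simp [hq, hmid]
  · rw [Finset.mem_singleton] at hq
    simp [hq, hhi, ownMeans]
  · by_cases hq : q = p
    · have : i ≠ Fin.castLE hn j := by simpa [hq] using h
      simp [ownMeans, hq, this]
    · simp [ownMeans, hq]

/-- The hard instances in which every player has a best arm of their own. -/
theorem exists_hard_own {T n : ℕ} (hn2 : 2 ≤ n) (hn : n ≤ K) (hM : 1 ≤ M) (hT : K ≤ T) :
    ∃ ε : ℝ, 0 < ε ∧ ∀ A : Algorithm M K T, ∃ E : Instance M K, E.IsDissimilar ε ∧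
      K - n ≤ (E.subpar ε).ncard ∧ M * (√(n * T) / 64) ≤ A.collectiveRegret E := by
  have hn0 : (0 : ℝ) < n := by exact_mod_cast (by omega : 0 < n)
  have hX : (n : ℝ) ≤ T := by exact_mod_cast hn.trans hT
  obtain ⟨Δ, h0, h1, hΔ, hreg⟩ := exists_gap hn0 hX
  obtain ⟨mid, hmid⟩ := exists_mean le_rfl (by norm_num)
  obtain ⟨hi, hhi⟩ := exists_mean h0.le h1
  rw [add_zero] at hmid
  have hbest (a : Fin M → Fin n) (p : Fin M) (k : Fin K) (hk : k ≠ Fin.castLE hn (a p)) :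
      (ownMeans hn hi mid a p k : ℝ) + Δ ≤ ownMeans hn hi mid a p (Fin.castLE hn (a p)) := by
    simp only [ownMeans, hk, if_true, if_false]
    split_ifs
    · rw [hmid, hhi]
    · simp [hhi]
  -- Across players an arm's mean varies by at most `Δ`, and the arms of mean zero have gap `1/2 + Δ
  -- > 5 Δ`.
  refine ⟨Δ, h0, fun A => ?_⟩
  -- With the best arms of the other players frozen, varying `a p` alone gives `n` bumps of one base
  -- matrix, that is, a single-player bandit with `T` pulls. Summing over all `a` then counts every
  -- assignment `n` times.
  have hp (p : Fin M) : (∑ _a : Fin M → Fin n, Δ * T / 4) ≤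
      ∑ a, A.playerRegret (bernoulliInstance (ownMeans hn hi mid a)) p := by
    have h2 (a : Fin M → Fin n) : n * (Δ * T / 4) ≤ ∑ j, A.playerRegret
        (bernoulliInstance (ownMeans hn hi mid (Function.update a p j))) p := by
      have h3 := A.le_sum_playerRegret_bump hn2 (Fin.castLE_injective hn)
        (isBump_ownMeans hn hmid hhi a p) h0.le (by linarith) (by simpa using hΔ)
        fun j q hq k hk => by
          rw [Finset.mem_singleton] at hq
          subst hq
          have h4 := hbest (Function.update a q j) q k
          rw [Function.update_self] at h4
          exact h4 hk
      simpa using h3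
    have h5 := Finset.sum_le_sum fun a (_ : a ∈ Finset.univ) => h2 a
    rw [sum_sum_update (fun a => A.playerRegret (bernoulliInstance (ownMeans hn hi mid a)) p) p,
      ← Finset.mul_sum, Fintype.card_fin] at h5
    exact le_of_mul_le_mul_left h5 hn0
  have hne : (Finset.univ : Finset (Fin M → Fin n)).Nonempty :=
    ⟨fun _ => ⟨0, by omega⟩, Finset.mem_univ _⟩
  obtain ⟨a, -, ha⟩ := Finset.exists_le_of_sum_le hne
    (f := fun _ => ∑ _p : Fin M, Δ * T / 4)
    (g := fun a => A.collectiveRegret (bernoulliInstance (ownMeans hn hi mid a))) (by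
      simp only [Algorithm.collectiveRegret]
      rw [Finset.sum_comm, Finset.sum_comm (s := Finset.univ (α := Fin M → Fin n))]
      exact Finset.sum_le_sum fun p _ => hp p)
  refine ⟨bernoulliInstance (ownMeans hn hi mid a), ⟨⟨h0.le, by linarith⟩, fun p q i => ?_⟩, ?_, ?_⟩
  · rw [mean_bernoulliInstance, mean_bernoulliInstance]
    by_cases hin : (i : ℕ) < n
    · simp only [ownMeans, hin, if_true]
      split_ifs <;> simp [hhi, hmid, abs_of_pos h0, h0.le]
    · have hne (r : Fin M) : i ≠ Fin.castLE hn (a r) := fun h => hin (by simp [h])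
      simp [ownMeans, hin, hne, h0.le]
  · have hsub : Set.range (fun i : Fin (K - n) => (⟨n + i, by omega⟩ : Fin K)) ⊆
        (bernoulliInstance (ownMeans hn hi mid a)).subpar Δ := by
      rintro _ ⟨i, rfl⟩
      refine ⟨⟨0, hM⟩, ?_⟩
      have h2 := (bernoulliInstance (ownMeans hn hi mid a)).sub_le_gap ⟨0, hM⟩ ⟨n + i, by omega⟩
        (Fin.castLE hn (a ⟨0, hM⟩))
      have hne : (⟨n + i, by omega⟩ : Fin K) ≠ Fin.castLE hn (a ⟨0, hM⟩) := fun h => by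
        have := congrArg Fin.val h
        have h5 := (a ⟨0, hM⟩).2
        simp only [Fin.val_castLE] at this
        omega
      rw [mean_bernoulliInstance, mean_bernoulliInstance] at h2
      simp only [ownMeans, hne, if_true, if_false, hhi] at h2
      have h6 : ¬ (n + (i : ℕ) < n) := by omega
      simp only [h6, if_false, Set.Icc.coe_zero] at h2
      change 5 * Δ < _
      linarith
    have h3 := Set.ncard_le_ncard hsub (Set.toFinite _)
    rw [Set.ncard_range_of_injective, Nat.card_eq_fintype_card, Fintype.card_fin] at h3
    · exact h3
    · intro i k hik
      have := congrArg Fin.val hik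
      simp only at this
      exact Fin.ext (by omega)
  · rw [← hreg]
    simpa using ha

end

end MPMAB

/-! ### Combination of the two families. -/

theorem theorem4 :
    ∃ c : ℝ, 0 < c ∧
      ∀ K M T l lC : ℕ, 2 ≤ K → 1 ≤ M → K ≤ T → l ≤ K - 1 → l + lC = K →
        ∃ ε : ℝ, 0 < ε ∧
          ∀ A : MPMAB.Algorithm M K T,
            ∃ E : MPMAB.Instance M K,
              E.IsDissimilar ε ∧
              l ≤ (E.subpar ε).ncard ∧
              c * ((M : ℝ) * Real.sqrt (((lC : ℝ) - 1) * (T : ℝ)) +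
                  Real.sqrt ((M : ℝ) * (l : ℝ) * (T : ℝ))) ≤ A.collectiveRegret E := by
  -- Each family loses a factor 64, and replacing a sum by twice its larger term loses another 2.
  refine ⟨1 / 128, by norm_num, fun K M T l lC hK hM hT hl hlK => ?_⟩
  rcases le_total ((M : ℝ) * √(((lC : ℝ) - 1) * T)) (√((M : ℝ) * l * T)) with hcase | hcase
  · obtain ⟨ε, hε, h⟩ := MPMAB.exists_hard_common (M := M) hK hM hT hl
    refine ⟨ε, hε, fun A => ?_⟩
    obtain ⟨E, h1, h2, h3⟩ := h A
    refine ⟨E, h1, h2, le_trans ?_ h3⟩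
    have hlK' : (l : ℝ) ≤ K := by exact_mod_cast (by omega : l ≤ K)
    have h4 : √((M : ℝ) * l * T) ≤ √(K * (M * T)) := by
      refine Real.sqrt_le_sqrt ?_
      calc (M : ℝ) * l * T = l * (M * T) := by ring
        _ ≤ K * (M * T) := by gcongr
    linarith
  -- `lC = 1` would make the dominating term zero, while the other is positive because `l = K - 1 ≥
  -- 1`. Hence there are at least two arms to hide a best one among.
  · have hlC : 2 ≤ lC := by
      by_contra hlt
      have h1 : lC = 1 := by omega
      have hl0 : 0 < l := by omega
      have hT0 : 0 < T := by omega
      have h2 : 0 < √((M : ℝ) * l * T) := by positivity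
      rw [h1] at hcase
      simp only [Nat.cast_one, sub_self, zero_mul, Real.sqrt_zero, mul_zero] at hcase
      linarith
    obtain ⟨ε, hε, h⟩ := MPMAB.exists_hard_own (M := M) (K := K) hlC (by omega) hM hT
    refine ⟨ε, hε, fun A => ?_⟩
    obtain ⟨E, h1, h2, h3⟩ := h A
    refine ⟨E, h1, by omega, le_trans ?_ h3⟩
    have h4 : (M : ℝ) * √(((lC : ℝ) - 1) * T) ≤ M * √(lC * T) := by
      gcongr
      linarith
    linarith
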